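/- Let $r\ge 0$, let $N=\mathrm{diag}(m_1,\dots,m_r)$ with integers $m_1\le\dots\le m_r$, and let $E_N=\bigoplus_j\mathcal O(m_j)$ be the bundle on $\mathbb{CP}^1$ with transition function $z^N$ between the trivializations over $\mathbb C$ (coordinate $z$) and over $\mathbb{CP}^1\setminus\{0\}$ (coordinate $\zeta=1/z$). An element of $\mathrm{Aut}(E_N)$ is a pair of holomorphic maps $g_0(z),g_1(\zeta)$ from $\mathbb C$ to $\mathrm{GL}(r,\mathbb C)$ with $g_0(z)=z^Ng_1(1/z)z^{-N}$ for $z\neq0$; it acts on connection forms over $\mathbb C$ by $g\cdot A=g_0Ag_0^{-1}-dg_0\,g_0^{-1}$. Let $z_1,\dots,z_{n-1}\in\mathbb C$ be distinct, $z_n=\infty$ ($n\ge1$), let $0\le\alpha_{i1}<\dots<\alpha_{ir}<1$ for $i=1,\dots,n$, put $W_i=\mathrm{diag}(\alpha_{i1},\dots,\alpha_{ir})$, and let $F_r$ be the descending flag of the spaces $\mathrm{Span}(e_j,\dots,e_r)$, $1\le j\le r$. Let $A$ be a logarithmic connection on $E_N$ adapted to complete descending flags $F_1,\dots,F_n$ and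 the weights $\alpha_{ij}$. This means that $A=\big(\sum_{i<n}\frac{A_i}{z-z_i}+f_0(z)\big)dz$ over $\mathbb C$ with $f_0$ entire, that $z^{-N}Az^N+N\,dz/z=\big(\frac{A_n}{\zeta}+\text{holomorphic}\big)d\zeta$ near $\zeta=0$, and that for each $i=1,\dots,n$ there is $B_i\in\mathrm{GL}(r,\mathbb C)$ with $A_i=B_iW_iB_i^{-1}$ and $F_i=B_i\cdot F_r$. Let $P_N\subset\mathrm{GL}(r,\mathbb C)$ be the group of invertible matrices $P$ with $P_{jk}=0$ whenever $m_j<m_k$. Then there is a permutation matrix $\Pi_n$ with $F_n\in P_N\Pi_n\cdot F_r$. For every such $\Pi_n$ (for instance the one for which $F_n$ lies in the Bruhat cell of $\Pi_n$), with $N'=\mathrm{Ad}(\Pi_n^{-1})(N)=\Pi_n^{-1}N\Pi_n$, the following hold. 1. There is $g\in\mathrm{Aut}(E_N)$ such that, in the trivialization over $\mathbb C$ with its frame permuted by $\Pi_n$, the connection $g\cdot A$ expands near $\infty$ as $$\Pi_n^{-1}(g\cdot A)\Pi_n=\Big(\frac{W_n+N'}{\zeta}+f_1'(\zeta)\Big)d\zeta,$$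 with $f_1'$ holomorphic at $\zeta=0$; equivalently, $g\cdot A=\big(\frac{\mathrm{Ad}(\Pi_n)(W_n+N')}{\zeta}+\text{holomorphic}\big)d\zeta$. 2. This normalization is essentially unique: for such a $g$, an element $h\in\mathrm{Aut}(E_N)$ also has the property in 1 (with the same $\Pi_n$) if and only if $h_0=Dg_0$ for a constant invertible diagonal matrix $D$. -/

import Mathlib

open Filter Topology

noncomputable section

/-- The adjoint action `Ad(g)(X) = g X g⁻¹` of an invertible matrix. -/
def matAd {r : ℕ} (g X : Matrix (Fin r) (Fin r) ℂ) : Matrix (Fin r) (Fin r) ℂ :=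
  g * X * g⁻¹

/-- The splitting matrix `N = diag(m₁, …, m_r)`. -/
def splitN {r : ℕ} (m : Fin r → ℤ) : Matrix (Fin r) (Fin r) ℂ :=
  Matrix.diagonal fun j => (m j : ℂ)

/-- The diagonal matrix `z ^ N = diag(z ^ m₁, …, z ^ m_r)`, used for `z ≠ 0`. -/
def powN {r : ℕ} (m : Fin r → ℤ) (z : ℂ) : Matrix (Fin r) (Fin r) ℂ :=
  Matrix.diagonal fun j => z ^ m j

/-- The diagonal matrix `diag(a₁, …, a_r)` of a system of real weights. -/
def weightW {r : ℕ} (a : Fin r → ℝ) : Matrix (Fin r) (Fin r) ℂ :=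
  Matrix.diagonal fun j => (a j : ℂ)

/-- A matrix-valued function on `ℂ` is entire. -/
def MatEntire {r : ℕ} (f : ℂ → Matrix (Fin r) (Fin r) ℂ) : Prop :=
  ∀ j k, Differentiable ℂ fun z => f z j k

/-- The entrywise complex derivative of a matrix-valued function. -/
def matDeriv {r : ℕ} (f : ℂ → Matrix (Fin r) (Fin r) ℂ) (z : ℂ) :
    Matrix (Fin r) (Fin r) ℂ :=
  Matrix.of fun j k => deriv (fun w => f w j k) z

/-- Near `ζ = 0`, the form `Φ(ζ) dζ` equals `(R / ζ + f(ζ)) dζ` with `f` holomorphic at `0`. -/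
def HasPolarPart {r : ℕ} (Φ : ℂ → Matrix (Fin r) (Fin r) ℂ)
    (R : Matrix (Fin r) (Fin r) ℂ) : Prop :=
  ∃ f : ℂ → Matrix (Fin r) (Fin r) ℂ, (∀ j k, AnalyticAt ℂ (fun ζ => f ζ j k) 0) ∧
    ∀ᶠ ζ in 𝓝[≠] (0 : ℂ), Φ ζ = ζ⁻¹ • R + f ζ

/-- The form `A(z) dz` rewritten in the coordinate `ζ = 1 / z`: since `dz = -ζ⁻² dζ`, it is
`-ζ⁻² A(1 / ζ) dζ`. -/
def inZeta {r : ℕ} (A : ℂ → Matrix (Fin r) (Fin r) ℂ) (ζ : ℂ) : Matrix (Fin r) (Fin r) ℂ :=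
  -((ζ ^ 2)⁻¹ • A ζ⁻¹)

/-- The connection form in the trivialization over the chart at `∞`, namely
`z ^ (-N) A(z) z ^ N dz + N dz / z`, in the coordinate `ζ = 1 / z`
(so that `z ^ (-N) = ζ ^ N` and `dz / z = -dζ / ζ`). -/
def formAtInfty {r : ℕ} (m : Fin r → ℤ) (A : ℂ → Matrix (Fin r) (Fin r) ℂ) (ζ : ℂ) :
    Matrix (Fin r) (Fin r) ℂ :=
  powN m ζ * inZeta A ζ * powN m ζ⁻¹ - ζ⁻¹ • splitN m

/-- The standard descending flag: the `j`-th space is spanned by `e_j, …, e_r`. -/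
def stdFlag (r : ℕ) (j : Fin r) : Submodule ℂ (Fin r → ℂ) :=
  Submodule.span ℂ {v | ∃ l, j ≤ l ∧ v = Pi.single l 1}

/-- The left action of matrices on families of subspaces (flags). -/
def flagAct {r : ℕ} (B : Matrix (Fin r) (Fin r) ℂ) (F : Fin r → Submodule ℂ (Fin r → ℂ)) :
    Fin r → Submodule ℂ (Fin r → ℂ) :=
  fun j => (F j).map B.mulVecLin

/-- The residue `R` is semisimple with ordered eigenvalues `a₁, …, a_r`, and its ordered eigenlines
span the complete descending flag `F`: `R = B diag(a) B⁻¹` where `F` is the image under `B` of the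
standard flag. -/
def ResidueAdapted {r : ℕ} (R : Matrix (Fin r) (Fin r) ℂ) (a : Fin r → ℝ)
    (F : Fin r → Submodule ℂ (Fin r → ℂ)) : Prop :=
  ∃ B : Matrix (Fin r) (Fin r) ℂ, IsUnit B ∧ R = matAd B (weightW a) ∧ F = flagAct B (stdFlag r)

/-- `A(z) dz` is a logarithmic connection on `E_N`, adapted to the flags `F` and the weights `α`,
with poles at the points `z i` of `ℂ` and at `∞` (which has the index `Fin.last k`).
The values of the function `A` at the points `z i` are irrelevant. -/
def IsAdaptedConnection {k r : ℕ} (z : Fin k → ℂ) (m : Fin r → ℤ)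
    (α : Fin (k + 1) → Fin r → ℝ) (F : Fin (k + 1) → Fin r → Submodule ℂ (Fin r → ℂ))
    (A : ℂ → Matrix (Fin r) (Fin r) ℂ) : Prop :=
  ∃ (R : Fin (k + 1) → Matrix (Fin r) (Fin r) ℂ) (f₀ : ℂ → Matrix (Fin r) (Fin r) ℂ),
    MatEntire f₀ ∧
    (∀ w, (∀ i, w ≠ z i) → A w = (∑ i : Fin k, (w - z i)⁻¹ • R i.castSucc) + f₀ w) ∧
    HasPolarPart (formAtInfty m A) (R (Fin.last k)) ∧
    ∀ i, ResidueAdapted (R i) (α i) (F i)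

/-- An automorphism of `E_N`: a pair of holomorphic maps `g₀`, `g₁` into `GL(r, ℂ)`, on the affine
charts with coordinates `z` and `ζ = 1 / z`, such that `g₀ = z ^ N g₁ z ^ (-N)` on the overlap. -/
structure BundleAut {r : ℕ} (m : Fin r → ℤ) where
  g₀ : ℂ → Matrix (Fin r) (Fin r) ℂ
  g₁ : ℂ → Matrix (Fin r) (Fin r) ℂ
  entire₀ : MatEntire g₀
  entire₁ : MatEntire g₁
  isUnit₀ : ∀ z, IsUnit (g₀ z)
  isUnit₁ : ∀ ζ, IsUnit (g₁ ζ)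
  transition : ∀ z, z ≠ 0 → g₀ z = powN m z * g₁ z⁻¹ * powN m z⁻¹

/-- The gauge action `g · A = g A g⁻¹ - dg g⁻¹`, in the trivialization over `ℂ`. -/
def BundleAut.act {r : ℕ} {m : Fin r → ℤ} (g : BundleAut m)
    (A : ℂ → Matrix (Fin r) (Fin r) ℂ) (z : ℂ) : Matrix (Fin r) (Fin r) ℂ :=
  g.g₀ z * A z * (g.g₀ z)⁻¹ - matDeriv g.g₀ z * (g.g₀ z)⁻¹

/-- The parabolic group `P_N`: the invertible matrices that are block lower triangular for the
partition of the indices into the level sets of the nondecreasing sequence `m`. -/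
def parabolicGroup {r : ℕ} (m : Fin r → ℤ) : Set (Matrix (Fin r) (Fin r) ℂ) :=
  {P | IsUnit P ∧ ∀ j k, m j < m k → P j k = 0}

/-- The permutation matrix `Π` of `σ` (entries `Π j k = δ_{σ(j) k}`) represents the Bruhat class
in `W_N \ W(r)` of the flag `F`. If `F` is the image of the standard flag under `C`, this says
`C = P Π L` with `P ∈ P_N` and `L` unipotent lower triangular. It holds in particular when `F` lies
in the Bruhat cell of `Π`, that is, when one can take `P` unipotent lower triangular. -/
def IsBruhatRep {r : ℕ} (m : Fin r → ℤ) (F : Fin r → Submodule ℂ (Fin r → ℂ))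
    (σ : Equiv.Perm (Fin r)) : Prop :=
  ∃ P ∈ parabolicGroup m, F = flagAct (P * σ.permMatrix ℂ) (stdFlag r)

/-- In the frame over `ℂ` permuted by `Π`, the connection `A` expands near `∞` as
`((W + N') / ζ + holomorphic) dζ` with `N' = Ad(Π⁻¹)(N)`: the polar part at `∞` of `A` itself,
in the trivialization over `ℂ`, is `Ad(Π)(W + N')`. -/
def IsNormalizedAtInfty {r : ℕ} (m : Fin r → ℤ) (a : Fin r → ℝ) (σ : Equiv.Perm (Fin r))
    (A : ℂ → Matrix (Fin r) (Fin r) ℂ) : Prop :=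
  HasPolarPart (inZeta A)
    (matAd (σ.permMatrix ℂ) (weightW a + matAd (σ.permMatrix ℂ)⁻¹ (splitN m)))

end

/-!
The normalization at `∞` splits into a local and a global problem. Locally, a connection form in
`ζ = 1 / z` with a nonresonant diagonalizable residue is brought to `ζ⁻¹ • diag b + O(ζ ^ T)`, for
any `T`, by a gauge transformation `Y` that is polynomial in `ζ`; for large `T` the error term stays
holomorphic after conjugation by `z ^ N`. Globally, it is enough to find an automorphism `g` of
`E_N` for which `z ^ N g₁ Y z ^ (-N)` is holomorphic at `ζ = 0` with value `1` there: this composite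
carries the form with residue `diag b + N` to `g · A`. Since the entry `(j, k)` of the matrix is
multiplied by `ζ ^ (m k - m j)`, and the entry `(j, l)` of `g₁` is an arbitrary polynomial of degree
at most `m j - m l`, this is a square linear system for each row of `g₁`, the congruence
`g₁ Y ≡ 1 mod ζ ^ (m j - m k + 1)`. It is uniquely solvable when the corners
`(Y(0) i l)`, `m i, m l ≤ c`, of `Y(0)` are invertible, and they are because `Π` represents
the Bruhat class of the flag at `∞`.

For the uniqueness, the quotient `q = h₀ g₀⁻¹` is a gauge transformation, meromorphic at `∞`,
between two forms with the same diagonal residue, whose entries are distinct modulo the integers.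
Comparing leading coefficients, `q` has no pole at `∞` and a diagonal value there, so it is constant
by Liouville's theorem.
-/

section PermMatrix

variable {n R : Type*} [Fintype n] [DecidableEq n] [CommRing R]

theorem isUnit_permMatrix (σ : Equiv.Perm n) : IsUnit (σ.permMatrix R) :=
  inv_inv σ ▸ (Group.isUnit σ⁻¹).map (Matrix.permMatrixHom (R := R))

theorem inv_permMatrix (σ : Equiv.Perm n) : (σ.permMatrix R)⁻¹ = σ⁻¹.permMatrix R :=
  Matrix.inv_eq_right_inv (by rw [← Matrix.permMatrix_mul, inv_mul_cancel, Matrix.permMatrix_one])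

theorem permMatrix_mul_mul_inv (σ : Equiv.Perm n) (M : Matrix n n R) :
    σ.permMatrix R * M * (σ.permMatrix R)⁻¹ = M.submatrix σ σ := by
  rw [inv_permMatrix, PEquiv.toMatrix_toPEquiv_mul, PEquiv.mul_toMatrix_toPEquiv,
    Matrix.submatrix_submatrix]
  rfl

end PermMatrix

section BruhatDecomposition

variable {n K β : Type*} [Field K] [LinearOrder β] {e : n → β}

/-- The index of the leading (first nonzero) entry of a vector, when the entries are ordered by a
key `e`. -/
def IsLeadingIndex (e : n → β) (v : n → K) (i : n) : Prop :=
  v i ≠ 0 ∧ ∀ l, e l < e i → v l = 0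

theorem exists_isLeadingIndex [Finite n] (e : n → β) {v : n → K} (hv : v ≠ 0) :
    ∃ i, IsLeadingIndex e v i := by
  obtain ⟨i, hi, hmin⟩ := Set.exists_min_image {i | v i ≠ 0} e (Set.toFinite _)
    (Function.ne_iff.1 hv)
  exact ⟨i, hi, fun l hl => by_contra fun hvl => (hmin l hvl).not_gt hl⟩

variable [LinearOrder n]

/-- The coefficient vectors `u` for which `B *ᵥ u` is the `j`-th column of `B` corrected by
multiples of later columns. -/
def columnCorrections (K : Type*) [Field K] (j : n) : Set (n → K) :=
  {u | u j = 1 ∧ ∀ k, k < j → u k = 0}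

theorem sub_smul_mem_columnCorrections {j j' : n} (hj : j < j') {u u' : n → K}
    (hu : u ∈ columnCorrections K j) (hu' : u' ∈ columnCorrections K j') (t : K) :
    u - t • u' ∈ columnCorrections K j := by
  refine ⟨by simp [hu.1, hu'.2 j hj], fun k hk => ?_⟩
  simp [hu.2 k hk, hu'.2 k (hk.trans hj)]

variable [Fintype n]

theorem mulVec_ne_zero_of_mem_columnCorrections {B : Matrix n n K} (hB : IsUnit B) {j : n}
    {u : n → K} (hu : u ∈ columnCorrections K j) : B.mulVec u ≠ 0 := by
  intro h
  have hu0 : u = 0 := Matrix.mulVec_injective_iff_isUnit.2 hB (h.trans (Matrix.mulVec_zero B).symm)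
  simpa [hu0] using hu.1

theorem exists_maximal_leadingIndex (e : n → β) {B : Matrix n n K} (hB : IsUnit B) (j : n) :
    ∃ i, ∃ u ∈ columnCorrections K j, IsLeadingIndex e (B.mulVec u) i ∧
      ∀ u' ∈ columnCorrections K j, ∀ i', IsLeadingIndex e (B.mulVec u') i' → e i' ≤ e i := by
  have hsingle : Pi.single j 1 ∈ columnCorrections K j :=
    ⟨Pi.single_eq_same j 1, fun k hk => Pi.single_eq_of_ne hk.ne 1⟩
  obtain ⟨i₀, hi₀⟩ :=
    exists_isLeadingIndex e (mulVec_ne_zero_of_mem_columnCorrections hB hsingle)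
  obtain ⟨i, ⟨u, hu, hi⟩, hmax⟩ := Set.exists_max_image
    {i | ∃ u ∈ columnCorrections K j, IsLeadingIndex e (B.mulVec u) i} e (Set.toFinite _)
    ⟨i₀, _, hsingle, hi₀⟩
  exact ⟨i, u, hu, hi, fun u' hu' i' hi' => hmax i' ⟨u', hu', hi'⟩⟩

theorem maximal_leadingIndex_ne (he : Function.Injective e) {B : Matrix n n K} (hB : IsUnit B)
    {j j' i i' : n} (hj : j < j') {u u' : n → K} (hu : u ∈ columnCorrections K j)
    (hu' : u' ∈ columnCorrections K j') (hi : IsLeadingIndex e (B.mulVec u) i)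
    (hi' : IsLeadingIndex e (B.mulVec u') i')
    (hmax : ∀ w ∈ columnCorrections K j, ∀ l, IsLeadingIndex e (B.mulVec w) l → e l ≤ e i) :
    i ≠ i' := by
  rintro rfl
  set w := u - (B.mulVec u i / B.mulVec u' i) • u' with hw
  have hmem : w ∈ columnCorrections K j := sub_smul_mem_columnCorrections hj hu hu' _
  have hvanish : ∀ l, e l ≤ e i → B.mulVec w l = 0 := by
    intro l hl
    rw [hw, Matrix.mulVec_sub, Matrix.mulVec_smul, Pi.sub_apply, Pi.smul_apply, smul_eq_mul]
    rcases hl.lt_or_eq with hlt | heq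
    · rw [hi.2 l hlt, hi'.2 l hlt, mul_zero, sub_zero]
    · rw [he heq, div_mul_cancel₀ _ hi'.1, sub_self]
  obtain ⟨l, hl⟩ := exists_isLeadingIndex e (mulVec_ne_zero_of_mem_columnCorrections hB hmem)
  exact hl.1 (hvanish l (hmax w hmem l hl))

theorem exists_bruhat_decomposition (he : Function.Injective e) {B : Matrix n n K}
    (hB : IsUnit B) :
    ∃ (P L : Matrix n n K) (σ : Equiv.Perm n), P.BlockTriangular (OrderDual.toDual ∘ e) ∧
      L.IsLowerTriangular ∧ (∀ j, L j j = 1) ∧ B * L = P * σ.permMatrix K := by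
  choose τ u hu hτ hmax using exists_maximal_leadingIndex e hB
  have hinj : Function.Injective τ := by
    intro j j' h
    by_contra hne
    rcases lt_or_gt_of_ne hne with hlt | hgt
    · exact maximal_leadingIndex_ne he hB hlt (hu j) (hu j') (hτ j) (hτ j') (hmax j) h
    · exact maximal_leadingIndex_ne he hB hgt (hu j') (hu j) (hτ j') (hτ j) (hmax j') h.symm
  let π : Equiv.Perm n := .ofBijective τ (Finite.injective_iff_bijective.1 hinj)
  let L : Matrix n n K := .of fun k j => u j k
  refine ⟨B * L * π.permMatrix K, L, π⁻¹, fun i k hik => ?_, fun k j hkj => (hu j).2 k hkj,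
    fun j => (hu j).1, ?_⟩
  · rw [PEquiv.mul_toMatrix_toPEquiv]
    refine (hτ (π.symm k)).2 i ?_
    rwa [show τ (π.symm k) = k from π.apply_symm_apply k]
  · rw [mul_assoc _ (π.permMatrix K), ← Matrix.permMatrix_mul, inv_mul_cancel,
      Matrix.permMatrix_one, mul_one]

end BruhatDecomposition

section Corners

variable {n R : Type*} [Fintype n] [CommRing R] {P L : Matrix n n R} {p : n → Prop}
  [DecidablePred p]

theorem toSquareBlockProp_mul_of_zero (h : ∀ i, p i → ∀ j, ¬p j → P i j = 0) (Q : Matrix n n R) :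
    (P * Q).toSquareBlockProp p = P.toSquareBlockProp p * Q.toSquareBlockProp p := by
  ext i k
  have hzero : ∑ j : {j // ¬p j}, P i j * Q j k = 0 :=
    Finset.sum_eq_zero fun j _ => by rw [h i i.2 j j.2, zero_mul]
  simp only [Matrix.toSquareBlockProp_def, Matrix.mul_apply, Matrix.of_apply]
  rw [← Fintype.sum_subtype_add_sum_subtype p, hzero, add_zero]

theorem isUnit_toSquareBlockProp_congr [DecidableEq n] {q : n → Prop} [DecidablePred q]
    (hpq : ∀ i, p i ↔ q i) : IsUnit (P.toSquareBlockProp p) ↔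
    IsUnit (P.toSquareBlockProp q) := by
  obtain rfl : p = q := funext fun i => propext (hpq i)
  convert Iff.rfl

theorem isUnit_toSquareBlockProp_of_zero [DecidableEq n] (hP : IsUnit P)
    (h : ∀ i, p i → ∀ j, ¬p j → P i j = 0) : IsUnit (P.toSquareBlockProp p) := by
  rw [Matrix.isUnit_iff_isUnit_det] at hP ⊢
  rw [Matrix.twoBlockTriangular_det' P p h] at hP
  exact isUnit_of_mul_isUnit_left hP

theorem isUnit_submatrix_of_isLowerTriangular [LinearOrder n] (hL : IsUnit L)
    (hlow : L.IsLowerTriangular) {ι : Type*} [Fintype ι] [DecidableEq ι] {f : ι → n}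
    (hf : Function.Injective f) : IsUnit (L.submatrix f f) := by
  let _ : LinearOrder ι := LinearOrder.lift' f hf
  rw [Matrix.isUnit_iff_isUnit_det, Matrix.det_of_isLowerTriangular L hlow,
    IsUnit.prod_univ_iff] at hL
  rw [Matrix.isUnit_iff_isUnit_det, Matrix.det_of_isLowerTriangular (L.submatrix f f)
    fun i j hij => hlow hij, IsUnit.prod_univ_iff]
  exact fun i => hL (f i)

theorem isUnit_toSquareBlockProp_mul_permMatrix_conj [LinearOrder n] (hP : IsUnit P)
    (h : ∀ i, p i → ∀ j, ¬p j → P i j = 0) (hL : IsUnit L) (hlow : L.IsLowerTriangular)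
    (σ : Equiv.Perm n) :
    IsUnit ((P * (σ.permMatrix R * L * (σ.permMatrix R)⁻¹)).toSquareBlockProp p) := by
  rw [toSquareBlockProp_mul_of_zero h, permMatrix_mul_mul_inv]
  exact (isUnit_toSquareBlockProp_of_zero hP h).mul
    (isUnit_submatrix_of_isLowerTriangular hL hlow (σ.injective.comp Subtype.val_injective))

end Corners

section Flags

variable {r : ℕ}

theorem mem_stdFlag {j : Fin r} {v : Fin r → ℂ} :
    v ∈ stdFlag r j ↔ ∀ l, l < j → v l = 0 := by
  constructor
  · intro hv l hl
    induction hv using Submodule.span_induction with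
    | mem x hx =>
      obtain ⟨i, hi, rfl⟩ := hx
      exact Pi.single_eq_of_ne (hl.trans_le hi).ne 1
    | zero => rfl
    | add x y _ _ hx hy => rw [Pi.add_apply, hx, hy, add_zero]
    | smul a x _ hx => rw [Pi.smul_apply, hx, smul_zero]
  · intro hv
    rw [pi_eq_sum_univ' v]
    refine Submodule.sum_mem _ fun i _ => ?_
    rcases lt_or_ge i j with hij | hji
    · rw [hv i hij, zero_smul]
      exact Submodule.zero_mem _
    · refine Submodule.smul_mem _ _ (Submodule.subset_span ⟨i, hji, ?_⟩)
      ext l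
      simp only [Pi.single_apply, eq_comm]

theorem flagAct_mul (A B : Matrix (Fin r) (Fin r) ℂ) (F : Fin r → Submodule ℂ (Fin r → ℂ)) :
    flagAct (A * B) F = flagAct A (flagAct B F) := by
  funext j
  simp only [flagAct, Matrix.mulVecLin_mul, Submodule.map_comp]

theorem flagAct_one (F : Fin r → Submodule ℂ (Fin r → ℂ)) : flagAct 1 F = F := by
  funext j
  simp only [flagAct, Matrix.mulVecLin_one, Submodule.map_id]

theorem flagAct_stdFlag_eq_iff {L : Matrix (Fin r) (Fin r) ℂ} (hL : IsUnit L) :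
    flagAct L (stdFlag r) = stdFlag r ↔ L.IsLowerTriangular := by
  constructor
  · intro h j k hjk
    have hmem : L.mulVecLin (Pi.single k 1) ∈ stdFlag r k := by
      rw [← congrFun h k]
      exact Submodule.mem_map_of_mem (Submodule.subset_span ⟨k, le_rfl, rfl⟩)
    simpa using mem_stdFlag.1 hmem j hjk
  · intro h
    funext j
    refine Submodule.eq_of_le_of_finrank_eq ?_ (LinearEquiv.finrank_map_eq
      (Matrix.toLinearEquiv' L (Matrix.invertibleOfIsUnitDet L
        ((Matrix.isUnit_iff_isUnit_det L).1 hL))) _)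
    rintro _ ⟨v, hv, rfl⟩
    refine mem_stdFlag.2 fun l hl => ?_
    simp only [Matrix.mulVecLin_apply, Matrix.mulVec, dotProduct]
    refine Finset.sum_eq_zero fun i _ => ?_
    rcases lt_or_ge i j with hij | hji
    · rw [mem_stdFlag.1 hv i hij, mul_zero]
    · rw [h (hl.trans_le hji), zero_mul]

theorem flagAct_stdFlag_eq_flagAct_stdFlag_iff {B C : Matrix (Fin r) (Fin r) ℂ} (hB : IsUnit B)
    (hC : IsUnit C) :
    flagAct B (stdFlag r) = flagAct C (stdFlag r) ↔
      ∃ L : Matrix (Fin r) (Fin r) ℂ, IsUnit L ∧ L.IsLowerTriangular ∧ B = C * L := by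
  have hdet := (Matrix.isUnit_iff_isUnit_det C).1 hC
  constructor
  · intro h
    have hL : IsUnit (C⁻¹ * B) := (Matrix.isUnit_nonsing_inv_iff.2 hC).mul hB
    refine ⟨C⁻¹ * B, hL, (flagAct_stdFlag_eq_iff hL).1 ?_, ?_⟩
    · rw [flagAct_mul, h, ← flagAct_mul, Matrix.nonsing_inv_mul C hdet, flagAct_one]
    · rw [← mul_assoc, Matrix.mul_nonsing_inv C hdet, one_mul]
  · rintro ⟨L, hL, hlow, rfl⟩
    rw [flagAct_mul, (flagAct_stdFlag_eq_iff hL).2 hlow]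

theorem exists_isBruhatRep (m : Fin r → ℤ) {B : Matrix (Fin r) (Fin r) ℂ} (hB : IsUnit B) :
    ∃ σ, IsBruhatRep m (flagAct B (stdFlag r)) σ := by
  have he : Function.Injective fun i => toLex (m i, i) :=
    fun i j h => congrArg (fun x => (ofLex x).2) h
  obtain ⟨P, L, σ, hP, hlow, hdiag, hPL⟩ := exists_bruhat_decomposition he hB
  have hL : IsUnit L := by
    rw [Matrix.isUnit_iff_isUnit_det, Matrix.det_of_isLowerTriangular L hlow]
    simp only [hdiag, Finset.prod_const_one, isUnit_one]
  have hPunit : IsUnit P := (isUnit_permMatrix σ).mul_right_iff.1 (hPL ▸ hB.mul hL)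
  refine ⟨σ, P, ⟨hPunit, fun j k hjk => hP (Prod.Lex.left _ _ hjk)⟩, ?_⟩
  rw [← hPL, flagAct_mul, (flagAct_stdFlag_eq_iff hL).2 hlow]

theorem IsBruhatRep.isUnit_corner {m : Fin r → ℤ} {B : Matrix (Fin r) (Fin r) ℂ}
    {σ : Equiv.Perm (Fin r)} (hσ : IsBruhatRep m (flagAct B (stdFlag r)) σ) (hB : IsUnit B)
    (c : ℤ) :
    IsUnit ((B * (σ.permMatrix ℂ)⁻¹).toSquareBlockProp fun i => m i ≤ c) := by
  obtain ⟨P, ⟨hP, hblock⟩, hflag⟩ := hσ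
  obtain ⟨L, hL, hlow, rfl⟩ := (flagAct_stdFlag_eq_flagAct_stdFlag_iff hB
    (hP.mul (isUnit_permMatrix σ))).1 hflag
  simpa only [mul_assoc] using isUnit_toSquareBlockProp_mul_permMatrix_conj hP
    (fun i hi j hj => hblock i j (hi.trans_lt (not_le.1 hj))) hL hlow σ

end Flags

section PolynomialSystem

open Polynomial

variable {n : Type*} [Fintype n]

theorem coeff_vecMul_of_X_pow_dvd {R : Type*} [CommRing R] {v : n → R[X]} {s : ℕ}
    (Y : Matrix n n R[X]) (hv : ∀ l, X ^ s ∣ v l) (k : n) :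
    (Matrix.vecMul v Y k).coeff s = ∑ l, (v l).coeff s * (Y l k).eval 0 := by
  choose w hw using hv
  simp only [Matrix.vecMul, dotProduct, finsetSum_coeff, hw, mul_assoc, coeff_X_pow_mul',
    le_refl, if_true, Nat.sub_self, coeff_zero_eq_eval_zero,
    eval_mul]

variable {K : Type*} [Field K] {d : n → ℕ} {Y : Matrix n n K[X]} [DecidableEq n]

theorem eq_zero_of_X_pow_dvd_vecMul
    (hY : ∀ s, IsUnit ((Y.map (eval 0)).toSquareBlockProp fun l => s < d l)) {v : n → K[X]}
    (hv : ∀ l, v l ∈ degreeLT K (d l)) (hdvd : ∀ k, X ^ d k ∣ Matrix.vecMul v Y k) : v = 0 := by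
  suffices hcoeff : ∀ s l, (v l).coeff s = 0 from
    funext fun l => Polynomial.ext fun s => by rw [hcoeff s l, Pi.zero_apply, coeff_zero]
  intro s
  induction s using Nat.strong_induction_on with
  | _ s ih =>
    have hhigh : ∀ l, ¬s < d l → (v l).coeff s = 0 := fun l hl =>
      coeff_eq_zero_of_degree_lt ((mem_degreeLT.1 (hv l)).trans_le (by exact_mod_cast not_lt.1 hl))
    have hrow : Matrix.vecMul (fun l : {l // s < d l} => (v l).coeff s)
        ((Y.map (eval 0)).toSquareBlockProp fun l => s < d l) = 0 := by
      funext k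
      have hk := coeff_vecMul_of_X_pow_dvd Y
        (fun l => X_pow_dvd_iff.2 fun t ht => ih t ht l) k
      rw [X_pow_dvd_iff.1 (hdvd k) s k.2, ← Fintype.sum_subtype_add_sum_subtype (s < d ·)] at hk
      rw [Finset.sum_eq_zero (s := (Finset.univ : Finset {l // ¬s < d l}))
        fun l _ => by rw [hhigh l l.2, zero_mul], add_zero] at hk
      exact hk.symm
    intro l
    by_cases hl : s < d l
    · exact congrFun (Matrix.vecMul_injective_of_isUnit (hY s)
        (hrow.trans (Matrix.zero_vecMul _).symm)) ⟨l, hl⟩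
    · exact hhigh l hl

/-- The endomorphism `v ↦ v Y mod X ^ d` of the rows of polynomials `v` with `deg (v l) < d l`. -/
noncomputable def vecMulModXPow (d : n → ℕ) (Y : Matrix n n K[X]) :
    (∀ l, degreeLT K (d l)) →ₗ[K] ∀ k, degreeLT K (d k) :=
  LinearMap.pi fun k => (modByMonicHom (X ^ d k)).codRestrict (degreeLT K (d k))
    (fun q => mem_degreeLT.2 ((degree_modByMonic_lt q (monic_X_pow _)).trans_eq (degree_X_pow _)))
    ∘ₗ LinearMap.proj k ∘ₗ (Y.vecMulLinear).restrictScalars K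
    ∘ₗ LinearMap.pi fun l => (degreeLT K (d l)).subtype ∘ₗ LinearMap.proj l

theorem exists_degreeLT_X_pow_dvd_vecMul_sub
    (hY : ∀ s, IsUnit ((Y.map (eval 0)).toSquareBlockProp fun l => s < d l)) (t : n → K[X]) :
    ∃ v : n → K[X], (∀ l, v l ∈ degreeLT K (d l)) ∧
      ∀ k, X ^ d k ∣ Matrix.vecMul v Y k - t k := by
  have := fun l => Module.Finite.of_surjective _ (degreeLTEquiv K (d l)).symm.surjective
  have hinj : Function.Injective (vecMulModXPow d Y) := by
    rw [← LinearMap.ker_eq_bot, LinearMap.ker_eq_bot']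
    intro v hv
    have hzero := eq_zero_of_X_pow_dvd_vecMul hY (fun l => (v l).2) fun k =>
      (modByMonic_eq_zero_iff_dvd (monic_X_pow _)).1 (congrArg Subtype.val (congrFun hv k))
    exact funext fun l => Subtype.ext (congrFun hzero l)
  obtain ⟨v, hv⟩ := LinearMap.injective_iff_surjective.1 hinj fun k => ⟨t k %ₘ X ^ d k,
    mem_degreeLT.2 ((degree_modByMonic_lt _ (monic_X_pow _)).trans_eq (degree_X_pow _))⟩
  refine ⟨fun l => v l, fun l => (v l).2, fun k => ?_⟩
  rw [← modByMonic_eq_zero_iff_dvd (monic_X_pow _), sub_modByMonic, sub_eq_zero]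
  exact congrArg Subtype.val (congrFun hv k)

end PolynomialSystem

section MatrixCalculus

open scoped Matrix.Norms.Operator

variable {r : ℕ} {f : ℂ → Matrix (Fin r) (Fin r) ℂ} {z : ℂ}

/-- A matrix as the family of its entries, with the operator norm on the one side and the sup norm
on the other: calculus for the operator norm is thereby calculus with entries. -/
noncomputable def entriesEquiv (r : ℕ) : Matrix (Fin r) (Fin r) ℂ ≃L[ℂ] (Fin r → Fin r → ℂ) :=
  (Matrix.ofLinearEquiv ℂ).symm.toContinuousLinearEquiv

theorem analyticAt_matrix_iff :
    AnalyticAt ℂ f z ↔ ∀ j k, AnalyticAt ℂ (fun w => f w j k) z := by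
  have hcomp : AnalyticAt ℂ f z ↔ AnalyticAt ℂ (fun w => entriesEquiv r (f w)) z :=
    ⟨fun hf => ((entriesEquiv r).analyticAt _).comp hf,
      fun hf => ((entriesEquiv r).symm.analyticAt _).comp hf⟩
  simp_rw [hcomp, analyticAt_pi_iff]
  rfl

theorem matEntire_iff_differentiable : MatEntire f ↔ Differentiable ℂ f := by
  have hcomp : Differentiable ℂ f ↔ Differentiable ℂ fun w => entriesEquiv r (f w) :=
    (entriesEquiv r).comp_differentiable_iff.symm
  simp_rw [hcomp, differentiable_pi]
  rfl

theorem matDeriv_eq_deriv (hf : DifferentiableAt ℂ f z) : matDeriv f z = deriv f z := by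
  have hderiv := (entriesEquiv r).hasFDerivAt.comp_hasDerivAt z hf.hasDerivAt
  ext j k
  exact (hasDerivAt_pi.1 (hasDerivAt_pi.1 hderiv j) k).deriv

theorem hasPolarPart_iff {Φ : ℂ → Matrix (Fin r) (Fin r) ℂ} {R : Matrix (Fin r) (Fin r) ℂ} :
    HasPolarPart Φ R ↔
      ∃ f, AnalyticAt ℂ f 0 ∧ Φ =ᶠ[𝓝[≠] 0] fun ζ => ζ⁻¹ • R + f ζ := by
  simp_rw [analyticAt_matrix_iff]
  rfl

end MatrixCalculus

section Gauge

variable {𝕜 𝔸 : Type*} [NontriviallyNormedField 𝕜] [NormedRing 𝔸] [NormedAlgebra 𝕜 𝔸]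
  {u v f Φ Ψ Θ : 𝕜 → 𝔸} {R R' : 𝔸} {ζ : 𝕜}

theorem eventually_isUnit {X A : Type*} [TopologicalSpace X] [NormedRing A]
    [HasSummableGeomSeries A] {f : X → A} {x : X} (hf : ContinuousAt f x) (hunit : IsUnit (f x)) :
    ∀ᶠ y in 𝓝[≠] x, IsUnit (f y) :=
  (hf.eventually (Units.isOpen.mem_nhds hunit)).filter_mono nhdsWithin_le_nhds

theorem exists_analyticAt_eq_add_smul (hf : AnalyticAt 𝕜 f 0) :
    ∃ g, AnalyticAt 𝕜 g 0 ∧ ∀ ζ, f ζ = f 0 + ζ • g ζ := by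
  obtain ⟨p, hp⟩ := hf
  refine ⟨dslope f 0, hp.has_fpower_series_dslope_fslope.analyticAt, fun ζ => ?_⟩
  rw [← sub_eq_iff_eq_add', ← sub_smul_dslope f 0 ζ, sub_zero]

/-- Near `ζ` the function `u` is a gauge transformation from the connection form `Φ dζ` to the
form `Ψ dζ`, that is `Ψ = u Φ u⁻¹ - du u⁻¹`; the equation is multiplied by `u` on the right, so
that it makes sense for every `u`. -/
def IsGaugeAt (u Φ Ψ : 𝕜 → 𝔸) (ζ : 𝕜) : Prop :=
  HasDerivAt u (u ζ * Φ ζ - Ψ ζ * u ζ) ζ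

theorem eventually_isGaugeAt_congr (huv : u =ᶠ[𝓝[≠] 0] v)
    (hu : ∀ᶠ ζ in 𝓝[≠] 0, IsGaugeAt u Φ Ψ ζ) : ∀ᶠ ζ in 𝓝[≠] 0, IsGaugeAt v Φ Ψ ζ := by
  filter_upwards [hu, eventually_nhdsNE_eventually_nhds_iff.2 huv] with ζ hζ heq
  rw [IsGaugeAt, ← heq.self_of_nhds]
  exact HasDerivAt.congr_of_eventuallyEq hζ (EventuallyEq.symm heq)

theorem IsGaugeAt.mul (hv : IsGaugeAt v Ψ Θ ζ) (hu : IsGaugeAt u Φ Ψ ζ) :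
    IsGaugeAt (fun ζ => v ζ * u ζ) Φ Θ ζ :=
  (HasDerivAt.fun_mul hv hu).congr_deriv (by noncomm_ring)

theorem IsGaugeAt.inverse [HasSummableGeomSeries 𝔸] (hu : IsGaugeAt u Φ Ψ ζ)
    (hunit : IsUnit (u ζ)) : IsGaugeAt (fun ζ => Ring.inverse (u ζ)) Ψ Φ ζ := by
  obtain ⟨x, hx⟩ := hunit
  have hinv := hasFDerivAt_ringInverse (𝕜 := 𝕜) x
  rw [hx] at hinv
  refine (hinv.comp_hasDerivAt ζ hu).congr_deriv ?_
  simp only [neg_apply, ContinuousLinearMap.mulLeftRight_apply, ← hx, Ring.inverse_unit]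
  simp only [mul_sub, sub_mul, mul_assoc, Units.mul_inv, mul_one, Units.inv_mul_cancel_left,
    neg_sub]

theorem IsGaugeAt.pow_smul (hu : IsGaugeAt u Φ Ψ ζ) (hζ : ζ ≠ 0) (s : ℕ) :
    IsGaugeAt (fun ζ => ζ ^ s • u ζ) (fun ζ => ζ⁻¹ • (s : 𝔸) + Φ ζ) Ψ ζ := by
  refine (HasDerivAt.fun_smul (hasDerivAt_pow s ζ) hu).congr_deriv ?_
  have hpow : (s : 𝕜) * ζ ^ (s - 1) = ζ⁻¹ * s * ζ ^ s := by
    cases s with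
    | zero => simp
    | succ s =>
      rw [Nat.add_sub_cancel]
      field_simp
      ring
  have hcast : (s : 𝔸) = (s : 𝕜) • 1 := by rw [← Algebra.algebraMap_eq_smul_one, map_natCast]
  rw [hpow, hcast]
  simp only [mul_add, smul_mul_assoc, mul_smul_comm, mul_one, smul_smul, smul_sub]
  abel

variable [CompleteSpace 𝔸]

theorem IsGaugeAt.residue_comm (hu : AnalyticAt 𝕜 u 0)
    (hΦ : Tendsto (fun ζ => ζ • Φ ζ) (𝓝[≠] 0) (𝓝 R))
    (hΨ : Tendsto (fun ζ => ζ • Ψ ζ) (𝓝[≠] 0) (𝓝 R'))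
    (hgauge : ∀ᶠ ζ in 𝓝[≠] 0, IsGaugeAt u Φ Ψ ζ) : R' * u 0 = u 0 * R := by
  have hu0 : Tendsto u (𝓝[≠] 0) (𝓝 (u 0)) := hu.continuousAt.tendsto.mono_left nhdsWithin_le_nhds
  have hzero : Tendsto (fun ζ => ζ • deriv u ζ) (𝓝[≠] 0) (𝓝 ((0 : 𝕜) • deriv u 0)) :=
    (continuousAt_id.smul hu.deriv.continuousAt).tendsto.mono_left nhdsWithin_le_nhds
  have hdiff : Tendsto (fun ζ => ζ • deriv u ζ) (𝓝[≠] 0) (𝓝 (u 0 * R - R' * u 0)) := by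
    refine ((hu0.mul hΦ).sub (hΨ.mul hu0)).congr' (hgauge.mono fun ζ hζ => ?_)
    change _ = ζ • deriv u ζ
    rw [HasDerivAt.deriv hζ, smul_sub, mul_smul_comm, smul_mul_assoc]
  have heq := tendsto_nhds_unique hdiff hzero
  rw [zero_smul, sub_eq_zero] at heq
  exact heq.symm

theorem analyticAt_ringInverse_comp (hu : AnalyticAt 𝕜 u ζ) (hunit : IsUnit (u ζ)) :
    AnalyticAt 𝕜 (fun ζ => Ring.inverse (u ζ)) ζ := by
  obtain ⟨x, hx⟩ := hunit
  exact (hx ▸ analyticAt_inverse x : AnalyticAt 𝕜 Ring.inverse (u ζ)).comp hu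

theorem IsGaugeAt.exists_polarPart (hu : AnalyticAt 𝕜 u 0) (hunit : IsUnit (u 0))
    (hf : AnalyticAt 𝕜 f 0)
    (hgauge : ∀ᶠ ζ in 𝓝[≠] 0, IsGaugeAt u (fun ζ => ζ⁻¹ • R + f ζ) Ψ ζ) :
    ∃ h, AnalyticAt 𝕜 h 0 ∧
      Ψ =ᶠ[𝓝[≠] 0] fun ζ => ζ⁻¹ • (u 0 * R * Ring.inverse (u 0)) + h ζ := by
  have hinv := analyticAt_ringInverse_comp hu hunit
  obtain ⟨g, hg, hgeq⟩ := exists_analyticAt_eq_add_smul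
    ((hu.fun_mul (analyticAt_const (v := R))).fun_mul hinv)
  refine ⟨fun ζ => g ζ + (u ζ * f ζ - deriv u ζ) * Ring.inverse (u ζ),
    hg.add (((hu.mul hf).sub hu.deriv).mul hinv), ?_⟩
  filter_upwards [hgauge, eventually_isUnit hu.continuousAt hunit,
    self_mem_nhdsWithin] with ζ hζ hunitζ hne
  calc Ψ ζ = Ψ ζ * u ζ * Ring.inverse (u ζ) := by
        rw [mul_assoc, Ring.mul_inverse_cancel _ hunitζ, mul_one]
    _ = ζ⁻¹ • (u ζ * R * Ring.inverse (u ζ))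
          + (u ζ * f ζ - deriv u ζ) * Ring.inverse (u ζ) := by
        rw [HasDerivAt.deriv hζ]
        simp only [mul_add, sub_mul, add_mul, mul_smul_comm, smul_mul_assoc]
        abel
    _ = _ := by
        rw [hgeq ζ, smul_add, inv_smul_smul₀ hne, add_assoc]

end Gauge

section PolarPart

open scoped Matrix.Norms.Operator

variable {r : ℕ} {u Φ Ψ : ℂ → Matrix (Fin r) (Fin r) ℂ} {R : Matrix (Fin r) (Fin r) ℂ}

theorem HasPolarPart.tendsto_smul (hΦ : HasPolarPart Φ R) :
    Tendsto (fun ζ => ζ • Φ ζ) (𝓝[≠] 0) (𝓝 R) := by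
  obtain ⟨f, hf, hΦf⟩ := hasPolarPart_iff.1 hΦ
  have hlim : Tendsto (fun ζ : ℂ => R + ζ • f ζ) (𝓝[≠] 0) (𝓝 (R + (0 : ℂ) • f 0)) :=
    (continuousAt_const.add (continuousAt_id.smul hf.continuousAt)).tendsto.mono_left
      nhdsWithin_le_nhds
  rw [zero_smul, add_zero] at hlim
  refine hlim.congr' ?_
  filter_upwards [hΦf, self_mem_nhdsWithin] with ζ hζ hne
  rw [hζ, smul_add, smul_inv_smul₀ hne]

theorem HasPolarPart.inv_smul_add (hΦ : HasPolarPart Φ R) (X : Matrix (Fin r) (Fin r) ℂ) :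
    HasPolarPart (fun ζ => ζ⁻¹ • X + Φ ζ) (X + R) := by
  obtain ⟨f, hf, hΦf⟩ := hΦ
  refine ⟨f, hf, hΦf.mono fun ζ hζ => ?_⟩
  simp only [hζ, smul_add, add_assoc]

theorem HasPolarPart.of_isGaugeAt (hΦ : HasPolarPart Φ R) (hu : AnalyticAt ℂ u 0)
    (hunit : IsUnit (u 0)) (hgauge : ∀ᶠ ζ in 𝓝[≠] 0, IsGaugeAt u Φ Ψ ζ) :
    HasPolarPart Ψ (matAd (u 0) R) := by
  obtain ⟨f, hf, hΦf⟩ := hasPolarPart_iff.1 hΦ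
  rw [hasPolarPart_iff, matAd, Matrix.nonsing_inv_eq_ringInverse]
  refine IsGaugeAt.exists_polarPart hu hunit hf (hgauge.mp (hΦf.mono fun ζ hζ hg => ?_))
  simpa only [IsGaugeAt, hζ] using hg

end PolarPart

section Transition

variable {r : ℕ} {m : Fin r → ℤ}

theorem powN_mul_powN_inv (m : Fin r → ℤ) {z : ℂ} (hz : z ≠ 0) : powN m z * powN m z⁻¹ = 1 := by
  simp only [powN, Matrix.diagonal_mul_diagonal, inv_zpow, mul_inv_cancel₀ (zpow_ne_zero _ hz),
    Matrix.diagonal_one]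

theorem powN_inv_mul_powN (m : Fin r → ℤ) {z : ℂ} (hz : z ≠ 0) : powN m z⁻¹ * powN m z = 1 :=
  mul_eq_one_comm.1 (powN_mul_powN_inv m hz)

theorem det_powN_conj (m : Fin r → ℤ) {z : ℂ} (hz : z ≠ 0) (M : Matrix (Fin r) (Fin r) ℂ) :
    (powN m z * M * powN m z⁻¹).det = M.det := by
  rw [Matrix.det_mul_comm, ← mul_assoc, powN_inv_mul_powN m hz, one_mul]

theorem apply_eq_of_tendsto_comp_inv {F : Type*} [NormedAddCommGroup F] [NormedSpace ℂ F]
    {f : ℂ → F} {c : F} (hf : Differentiable ℂ f)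
    (hlim : Tendsto (fun ζ => f ζ⁻¹) (𝓝[≠] 0) (𝓝 c)) (z : ℂ) : f z = c := by
  refine hf.apply_eq_of_tendsto_cocompact z ?_
  rw [← Metric.cobounded_eq_cocompact]
  simpa only [Function.comp_def, inv_inv] using hlim.comp (tendsto_inv₀_cobounded' (α := ℂ))

open Polynomial

theorem eval_reflect_of_mem_degreeLT {K : Type*} [Field K] {a b : ℤ} {p : K[X]}
    (hp : p ∈ degreeLT K (a - b + 1).toNat) {z : K} (hz : z ≠ 0) :
    (reflect (a - b).toNat p).eval z = z ^ a * p.eval z⁻¹ * z⁻¹ ^ b := by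
  rcases eq_or_ne p 0 with rfl | hp0
  · simp
  have hdeg := (natDegree_lt_iff_degree_lt hp0).2 (mem_degreeLT.1 hp)
  have : Invertible z⁻¹ := invertibleOfNonzero (inv_ne_zero hz)
  have hreflect := eval₂_reflect_mul_pow (RingHom.id K) z⁻¹ (a - b).toNat p (by omega)
  rw [← eval, ← eval, invOf_eq_inv, inv_inv] at hreflect
  have hpow : z ^ (a - b).toNat = z ^ a * z⁻¹ ^ b := by
    rw [inv_zpow', ← zpow_add₀ hz, ← zpow_natCast, Int.toNat_of_nonneg (by omega), sub_eq_add_neg]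
  rw [mul_right_comm, ← hpow, ← hreflect, mul_left_comm, ← mul_pow, mul_inv_cancel₀ hz, one_pow,
    mul_one]

/-- The polynomial endomorphism `z ^ N V(1 / z) z ^ (-N)` of `E_N` over `ℂ`, for a matrix `V` of
polynomials in `ζ = 1 / z` whose entries satisfy `deg V j l ≤ m j - m l`. -/
noncomputable def reflectMatrix (m : Fin r → ℤ) (V : Matrix (Fin r) (Fin r) ℂ[X]) :
    Matrix (Fin r) (Fin r) ℂ[X] :=
  Matrix.of fun j l => reflect (m j - m l).toNat (V j l)

variable {V : Matrix (Fin r) (Fin r) ℂ[X]}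

theorem map_eval_reflectMatrix (hV : ∀ j l, V j l ∈ degreeLT ℂ (m j - m l + 1).toNat) {z : ℂ}
    (hz : z ≠ 0) :
    (reflectMatrix m V).map (eval z) = powN m z * V.map (eval z⁻¹) * powN m z⁻¹ := by
  ext j l
  rw [powN, powN, Matrix.mul_diagonal, Matrix.diagonal_mul]
  exact eval_reflect_of_mem_degreeLT (hV j l) hz

theorem eval_inv_det_reflectMatrix (hV : ∀ j l, V j l ∈ degreeLT ℂ (m j - m l + 1).toNat) {ζ : ℂ}
    (hζ : ζ ≠ 0) : (reflectMatrix m V).det.eval ζ⁻¹ = V.det.eval ζ :=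
  calc (reflectMatrix m V).det.eval ζ⁻¹ = ((reflectMatrix m V).map (eval ζ⁻¹)).det :=
        (evalRingHom ζ⁻¹).map_det _
    _ = (V.map (eval ζ)).det := by
        rw [map_eval_reflectMatrix hV (inv_ne_zero hζ), det_powN_conj m (inv_ne_zero hζ), inv_inv]
    _ = V.det.eval ζ := ((evalRingHom ζ).map_det V).symm

theorem eval_det_reflectMatrix (hV : ∀ j l, V j l ∈ degreeLT ℂ (m j - m l + 1).toNat) (z : ℂ) :
    (reflectMatrix m V).det.eval z = V.det.eval 0 := by
  refine apply_eq_of_tendsto_comp_inv (Polynomial.differentiable _) ?_ z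
  refine ((V.det.continuous.tendsto 0).mono_left nhdsWithin_le_nhds).congr' ?_
  filter_upwards [self_mem_nhdsWithin] with ζ hζ using (eval_inv_det_reflectMatrix hV hζ).symm

theorem eval_det_of_mem_degreeLT (hV : ∀ j l, V j l ∈ degreeLT ℂ (m j - m l + 1).toNat) (ζ : ℂ) :
    V.det.eval ζ = V.det.eval 0 := by
  rcases eq_or_ne ζ 0 with rfl | hζ
  · rfl
  · rw [← eval_inv_det_reflectMatrix hV hζ, eval_det_reflectMatrix hV]

/-- The automorphism of `E_N` that is given over the chart at `∞` by a matrix of polynomials. -/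
noncomputable def BundleAut.ofDegreeLT (V : Matrix (Fin r) (Fin r) ℂ[X])
    (hV : ∀ j l, V j l ∈ degreeLT ℂ (m j - m l + 1).toNat) (hdet : V.det.eval 0 ≠ 0) :
    BundleAut m where
  g₀ z := (reflectMatrix m V).map (eval z)
  g₁ ζ := V.map (eval ζ)
  entire₀ j l := (reflectMatrix m V j l).differentiable
  entire₁ j l := (V j l).differentiable
  isUnit₀ z := by
    rw [Matrix.isUnit_iff_isUnit_det, isUnit_iff_ne_zero]
    exact ((evalRingHom z).map_det _).symm.trans_ne
      ((eval_det_reflectMatrix hV z).trans_ne hdet)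
  isUnit₁ ζ := by
    rw [Matrix.isUnit_iff_isUnit_det, isUnit_iff_ne_zero]
    exact ((evalRingHom ζ).map_det _).symm.trans_ne ((eval_det_of_mem_degreeLT hV ζ).trans_ne hdet)
  transition _ hz := map_eval_reflectMatrix hV hz

theorem eval_zero_det_of_X_pow_dvd_sub_one {R n : Type*} [CommRing R] [Fintype n] [DecidableEq n]
    {m : n → ℤ} {M : Matrix n n R[X]} (hM : ∀ j k, X ^ (m j - m k + 1).toNat ∣ (M - 1) j k) :
    M.det.eval 0 = 1 := by
  have hentry : ∀ j k, m k ≤ m j → (M j k).eval 0 = (1 : Matrix n n R) j k := by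
    intro j k hjk
    have hdvd := (dvd_pow_self (X : R[X]) (by omega)).trans (hM j k)
    rw [X_dvd_iff, coeff_zero_eq_eval_zero, Matrix.sub_apply, eval_sub, sub_eq_zero] at hdvd
    rw [hdvd, Matrix.one_apply, Matrix.one_apply]
    split_ifs <;> simp
  have htriangular : (M.map (eval 0)).BlockTriangular m := fun j k hjk => by
    rw [Matrix.map_apply, hentry j k hjk.le, Matrix.one_apply_ne fun h => hjk.ne (by rw [h])]
  calc M.det.eval 0 = (M.map (eval 0)).det := (evalRingHom 0).map_det M
    _ = ∏ c ∈ Finset.univ.image m, ((M.map (eval 0)).toSquareBlock m c).det := htriangular.det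
    _ = 1 := Finset.prod_eq_one fun c _ => ?_
  have hblock : (M.map (eval 0)).toSquareBlock m c = 1 := by
    ext ⟨j, hj⟩ ⟨k, hk⟩
    rw [Matrix.toSquareBlock_def, Matrix.of_apply, Matrix.map_apply,
      hentry j k (hk.trans hj.symm).le, Matrix.one_apply, Matrix.one_apply]
    simp only [Subtype.mk.injEq]
  rw [hblock, Matrix.det_one]

theorem exists_powN_conj_eq_one_add_smul {M : Matrix (Fin r) (Fin r) ℂ[X]}
    (hM : ∀ j k, X ^ (m j - m k + 1).toNat ∣ (M - 1) j k) :
    ∃ H : Matrix (Fin r) (Fin r) ℂ[X], ∀ ζ, ζ ≠ 0 →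
      powN m ζ⁻¹ * M.map (eval ζ) * powN m ζ = 1 + ζ • H.map (eval ζ) := by
  choose q hq using hM
  refine ⟨Matrix.of fun j k => X ^ (m k - m j + (m j - m k + 1).toNat - 1).toNat * q j k,
    fun ζ hζ => ?_⟩
  have hMeval : M.map (eval ζ) = 1 + (M - 1).map (eval ζ) := by
    ext j k
    simp only [Matrix.add_apply, Matrix.map_apply, Matrix.sub_apply, eval_sub, Matrix.one_apply]
    split_ifs <;> simp
  rw [hMeval, mul_add, add_mul, mul_one, powN_inv_mul_powN m hζ]
  congr 1
  ext j k
  have hpow : ζ⁻¹ ^ m j * ζ ^ (m j - m k + 1).toNat * ζ ^ m k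
      = ζ * ζ ^ (m k - m j + (m j - m k + 1).toNat - 1).toNat := by
    rw [inv_zpow', ← zpow_natCast, ← zpow_natCast, ← zpow_add₀ hζ, ← zpow_add₀ hζ,
      ← zpow_one_add₀ hζ]
    congr 1
    omega
  simp only [powN, Matrix.mul_diagonal, Matrix.diagonal_mul, Matrix.map_apply, hq, eval_mul,
    eval_pow, eval_X, Matrix.smul_apply, Matrix.of_apply, smul_eq_mul]
  rw [← mul_assoc, mul_right_comm, hpow, mul_assoc]

theorem exists_bundleAut_mul_eq_one_add_smul {Y : Matrix (Fin r) (Fin r) ℂ[X]}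
    (hY : ∀ c : ℤ, IsUnit ((Y.map (eval 0)).toSquareBlockProp fun i => m i ≤ c)) :
    ∃ (g : BundleAut m) (H : Matrix (Fin r) (Fin r) ℂ[X]), ∀ ζ, ζ ≠ 0 →
      powN m ζ⁻¹ * (g.g₁ ζ * Y.map (eval ζ)) * powN m ζ = 1 + ζ • H.map (eval ζ) := by
  have hcorner : ∀ (j : Fin r) (s : ℕ),
      IsUnit ((Y.map (eval 0)).toSquareBlockProp fun l => s < (m j - m l + 1).toNat) := by
    intro j s
    have hiff : ∀ l, s < (m j - m l + 1).toNat ↔ m l ≤ m j - s := fun l => by omega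
    exact (isUnit_toSquareBlockProp_congr hiff).2 (hY (m j - s))
  choose V hV hdvd using fun j => exists_degreeLT_X_pow_dvd_vecMul_sub (hcorner j)
    ((1 : Matrix (Fin r) (Fin r) ℂ[X]) j)
  have hM : ∀ j k, X ^ (m j - m k + 1).toNat ∣ (Matrix.of V * Y - 1) j k := hdvd
  have hdet := eval_zero_det_of_X_pow_dvd_sub_one hM
  rw [Matrix.det_mul, eval_mul] at hdet
  obtain ⟨H, hH⟩ := exists_powN_conj_eq_one_add_smul hM
  refine ⟨.ofDegreeLT (Matrix.of V) hV (left_ne_zero_of_mul_eq_one hdet), H, fun ζ hζ => ?_⟩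
  rw [← hH ζ hζ]
  congr 2
  exact (Matrix.map_mul (f := evalRingHom ζ)).symm

end Transition

section AffineForm

open scoped Matrix.Norms.Operator

variable {r : ℕ} {m : Fin r → ℤ} {ζ : ℂ}

theorem BundleAut.isGaugeAt (g : BundleAut m) (A : ℂ → Matrix (Fin r) (Fin r) ℂ) (hζ : ζ ≠ 0) :
    IsGaugeAt (fun ζ => g.g₀ ζ⁻¹) (inZeta A) (inZeta (g.act A)) ζ := by
  have hdiff := matEntire_iff_differentiable.1 g.entire₀ ζ⁻¹
  have hunit := (Matrix.isUnit_iff_isUnit_det _).1 (g.isUnit₀ ζ⁻¹)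
  refine (hdiff.hasDerivAt.scomp ζ (hasDerivAt_inv hζ)).congr_deriv ?_
  simp only [inZeta, BundleAut.act, matDeriv_eq_deriv hdiff, neg_mul, mul_neg, smul_mul_assoc,
    mul_smul_comm, sub_mul, mul_assoc, Matrix.nonsing_inv_mul _ hunit, mul_one, smul_sub,
    neg_smul]
  abel

theorem hasDerivAt_powN (hζ : ζ ≠ 0) :
    HasDerivAt (powN m) (powN m ζ * ζ⁻¹ • splitN m) ζ := by
  have hentries := hasDerivAt_pi.2 fun j => hasDerivAt_zpow (m j) ζ (Or.inl hζ)
  refine ((Matrix.diagonalLinearMap (Fin r) ℂ ℂ).toContinuousLinearMap.hasFDerivAt.comp_hasDerivAt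
    ζ hentries).congr_deriv ?_
  rw [powN, splitN, ← Matrix.diagonal_smul, Matrix.diagonal_mul_diagonal]
  refine congrArg Matrix.diagonal (funext fun j => ?_)
  rw [zpow_sub_one₀ hζ, Pi.smul_apply, smul_eq_mul]
  ring

theorem powN_inv (m : Fin r → ℤ) (ζ : ℂ) : powN m ζ⁻¹ = powN (-m) ζ := by
  simp only [powN, inv_zpow', Pi.neg_apply]

/-- The connection form over `ℂ`, in the coordinate `ζ = 1 / z`, of the connection on `E_N` whose
form over the chart at `∞` is `Φ dζ`: the inverse of `formAtInfty`. -/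
noncomputable def affineForm (m : Fin r → ℤ) (Φ : ℂ → Matrix (Fin r) (Fin r) ℂ) (ζ : ℂ) :
    Matrix (Fin r) (Fin r) ℂ :=
  powN m ζ⁻¹ * Φ ζ * powN m ζ + ζ⁻¹ • splitN m

variable {Φ : ℂ → Matrix (Fin r) (Fin r) ℂ}

theorem affineForm_formAtInfty (A : ℂ → Matrix (Fin r) (Fin r) ℂ) (hζ : ζ ≠ 0) :
    affineForm m (formAtInfty m A) ζ = inZeta A ζ := by
  have hcomm : powN m ζ⁻¹ * splitN m = splitN m * powN m ζ⁻¹ := by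
    simp only [powN, splitN, Matrix.diagonal_mul_diagonal, mul_comm]
  have hconj : powN m ζ⁻¹ * (powN m ζ * inZeta A ζ * powN m ζ⁻¹) * powN m ζ = inZeta A ζ := by
    simp only [mul_assoc, powN_inv_mul_powN m hζ, mul_one]
    rw [← mul_assoc, powN_inv_mul_powN m hζ, one_mul]
  rw [affineForm, formAtInfty, mul_sub, sub_mul, hconj, mul_smul_comm, hcomm, smul_mul_assoc,
    mul_assoc, powN_inv_mul_powN m hζ, mul_one, sub_add_cancel]

theorem isGaugeAt_powN (hζ : ζ ≠ 0) : IsGaugeAt (powN m) (affineForm m Φ) Φ ζ := by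
  refine (hasDerivAt_powN hζ).congr_deriv ?_
  rw [affineForm, mul_add, ← mul_assoc, ← mul_assoc, powN_mul_powN_inv m hζ, one_mul,
    add_sub_cancel_left]

theorem isGaugeAt_powN_inv (hζ : ζ ≠ 0) :
    IsGaugeAt (fun ζ => powN m ζ⁻¹) Φ (affineForm m Φ) ζ := by
  simp only [powN_inv]
  have hsplit : splitN (-m) = -splitN m := by
    simp only [splitN, Pi.neg_apply, Int.cast_neg, ← Matrix.diagonal_neg]
  have hcomm : splitN m * powN (-m) ζ = powN (-m) ζ * splitN m := by
    simp only [powN, splitN, Matrix.diagonal_mul_diagonal, mul_comm]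
  refine (hasDerivAt_powN hζ).congr_deriv ?_
  beta_reduce
  rw [affineForm, add_mul, mul_assoc _ (powN m ζ), ← powN_inv, powN_mul_powN_inv m hζ, mul_one,
    sub_add_cancel_left, powN_inv, hsplit, smul_mul_assoc, hcomm, mul_smul_comm, mul_neg, smul_neg]

theorem exists_pow_smul_powN_conj_analyticAt (m : Fin r → ℤ) :
    ∃ T : ℕ, ∀ f : ℂ → Matrix (Fin r) (Fin r) ℂ, AnalyticAt ℂ f 0 →
      ∃ F, AnalyticAt ℂ F 0 ∧ ∀ ζ, ζ ≠ 0 → ζ ^ T • (powN m ζ⁻¹ * f ζ * powN m ζ) = F ζ := by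
  let T := Finset.univ.sup fun p : Fin r × Fin r => (m p.1 - m p.2).toNat
  have hT : ∀ j k, (m j - m k).toNat ≤ T := fun j k =>
    Finset.le_sup (f := fun p : Fin r × Fin r => (m p.1 - m p.2).toNat) (Finset.mem_univ (j, k))
  refine ⟨T, fun f hf => ⟨fun ζ => Matrix.of fun j k => ζ ^ (T - m j + m k).toNat * f ζ j k,
    analyticAt_matrix_iff.2 fun j k =>
      (analyticAt_id.fun_pow _).fun_mul (analyticAt_matrix_iff.1 hf j k), fun ζ hζ => ?_⟩⟩
  ext j k
  have hpow : ζ ^ T * ζ⁻¹ ^ m j * ζ ^ m k = ζ ^ (T - m j + m k).toNat := by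
    have := hT j k
    rw [inv_zpow', ← zpow_natCast, ← zpow_natCast, ← zpow_add₀ hζ, ← zpow_add₀ hζ,
      Int.toNat_of_nonneg (by omega), sub_eq_add_neg]
  simp only [powN, Matrix.smul_apply, Matrix.mul_diagonal, Matrix.diagonal_mul, Matrix.of_apply,
    smul_eq_mul]
  rw [← hpow]
  ring

end AffineForm

section ApproximateGauge

variable {𝕜 𝔸 : Type*} [NontriviallyNormedField 𝕜] [NormedRing 𝔸] [NormedAlgebra 𝕜 𝔸]
  [CompleteSpace 𝔸]

theorem exists_isGaugeAt_one_add_pow_smul {E : 𝕜 → 𝔸} (hE : AnalyticAt 𝕜 E 0) {D x : 𝔸} {T : ℕ}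
    (hx : D * x - x * D + ((T : 𝕜) + 1) • x = -E 0) :
    ∃ E', AnalyticAt 𝕜 E' 0 ∧ ∀ᶠ ζ in 𝓝[≠] 0, IsGaugeAt (fun ζ => 1 + ζ ^ (T + 1) • x)
      (fun ζ => ζ⁻¹ • D + ζ ^ (T + 1) • E' ζ) (fun ζ => ζ⁻¹ • D + ζ ^ T • E ζ) ζ := by
  let v : 𝕜 → 𝔸 := fun ζ => 1 + ζ ^ (T + 1) • x
  have hv0 : v 0 = 1 := by
    simp only [v, zero_pow T.succ_ne_zero, zero_smul, add_zero]
  have hv : AnalyticAt 𝕜 v 0 :=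
    analyticAt_const.add ((analyticAt_id.fun_pow _).smul analyticAt_const)
  have hunit : IsUnit (v 0) := hv0 ▸ isUnit_one
  obtain ⟨G, hG, hEv⟩ := exists_analyticAt_eq_add_smul (hE.fun_mul hv)
  refine ⟨fun ζ => Ring.inverse (v ζ) * G ζ, (analyticAt_ringInverse_comp hv hunit).mul hG, ?_⟩
  filter_upwards [eventually_isUnit hv.continuousAt hunit, self_mem_nhdsWithin] with ζ hunitζ hζ
  have hderiv : HasDerivAt v ((((T : 𝕜) + 1) * ζ ^ T) • x) ζ := by
    simpa [v] using ((hasDerivAt_pow (T + 1) ζ).smul_const x).const_add 1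
  have hcomm : v ζ * D - D * v ζ = ζ ^ (T + 1) • (x * D - D * x) := by
    simp only [v, add_mul, mul_add, one_mul, mul_one, smul_mul_assoc, mul_smul_comm, smul_sub,
      add_sub_add_left_eq_sub]
  rw [hv0, mul_one] at hEv
  refine hderiv.congr_deriv ?_
  calc (((T : 𝕜) + 1) * ζ ^ T) • x = ζ ^ T • (((T : 𝕜) + 1) • x) := by rw [smul_smul, mul_comm]
    _ = ζ ^ T • (x * D - D * x) + ζ ^ (T + 1) • G ζ - ζ ^ T • (E ζ * v ζ) := by
        rw [hEv, pow_succ, mul_smul, ← smul_add, ← smul_sub]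
        congr 1
        rw [← sub_eq_zero, ← sub_eq_zero.2 hx]
        abel
    _ = ζ⁻¹ • (v ζ * D - D * v ζ) + ζ ^ (T + 1) • G ζ - ζ ^ T • (E ζ * v ζ) := by
        rw [hcomm, pow_succ' ζ, mul_smul, mul_smul, inv_smul_smul₀ hζ]
    _ = v ζ * (ζ⁻¹ • D + ζ ^ (T + 1) • (Ring.inverse (v ζ) * G ζ))
          - (ζ⁻¹ • D + ζ ^ T • E ζ) * v ζ := by
        simp only [mul_add, add_mul, mul_smul_comm, smul_mul_assoc, smul_sub,
          Ring.mul_inverse_cancel_left _ _ hunitζ]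
        abel

theorem exists_diagonal_commutator_add_smul_eq {n K : Type*} [Fintype n] [DecidableEq n] [Field K]
    {b : n → K} {c : K} (hb : ∀ j k, b j - b k + c ≠ 0) (M : Matrix n n K) :
    ∃ x, Matrix.diagonal b * x - x * Matrix.diagonal b + c • x = M := by
  refine ⟨Matrix.of fun j k => M j k / (b j - b k + c), ?_⟩
  ext j k
  simp only [Matrix.add_apply, Matrix.sub_apply, Matrix.smul_apply, Matrix.diagonal_mul,
    Matrix.mul_diagonal, Matrix.of_apply, smul_eq_mul]
  field_simp [hb j k]

open scoped Matrix.Norms.Operator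
open Polynomial

variable {r : ℕ} {Φ : ℂ → Matrix (Fin r) (Fin r) ℂ} {b : Fin r → ℂ}

theorem exists_polynomial_gauge {Y₀ : Matrix (Fin r) (Fin r) ℂ}
    (hΦ : HasPolarPart Φ (matAd Y₀ (Matrix.diagonal b))) (hY₀ : IsUnit Y₀)
    (hb : ∀ j k, ∀ s : ℕ, b j - b k + (s + 1) ≠ 0) (T : ℕ) :
    ∃ Y : Matrix (Fin r) (Fin r) ℂ[X], Y.map (eval 0) = Y₀ ∧
      ∃ E, AnalyticAt ℂ E 0 ∧ ∀ᶠ ζ in 𝓝[≠] 0, IsGaugeAt (fun ζ => Y.map (eval ζ))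
        (fun ζ => ζ⁻¹ • Matrix.diagonal b + ζ ^ T • E ζ) Φ ζ := by
  induction T with
  | zero =>
    obtain ⟨f, hf, hΦf⟩ := hasPolarPart_iff.1 hΦ
    have hconst : ∀ ζ, (Y₀.map C).map (eval ζ) = Y₀ := fun ζ => by
      ext
      simp
    have hdet := (Matrix.isUnit_iff_isUnit_det _).1 hY₀
    refine ⟨Y₀.map C, hconst 0, fun ζ => Y₀⁻¹ * f ζ * Y₀,
      (analyticAt_const.mul hf).mul analyticAt_const, hΦf.mono fun ζ hζ => ?_⟩
    simp only [hconst]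
    refine (hasDerivAt_const ζ Y₀).congr_deriv ?_
    rw [hζ]
    simp only [matAd, add_mul, mul_add, smul_mul_assoc, mul_smul_comm, mul_assoc, pow_zero,
      one_smul, Matrix.mul_nonsing_inv_cancel_left _ _ hdet, Matrix.nonsing_inv_mul _ hdet,
      mul_one, sub_self]
  | succ T ih =>
    obtain ⟨Y, hY, E, hE, hgauge⟩ := ih
    obtain ⟨x, hx⟩ := exists_diagonal_commutator_add_smul_eq (fun j k => hb j k T) (-E 0)
    obtain ⟨E', hE', hstep⟩ := exists_isGaugeAt_one_add_pow_smul hE hx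
    have heval : ∀ ζ, (Y * (1 + (X ^ (T + 1) : ℂ[X]) • x.map C)).map (eval ζ)
        = Y.map (eval ζ) * (1 + ζ ^ (T + 1) • x) := by
      intro ζ
      rw [← coe_evalRingHom, Matrix.map_mul]
      congr 1
      ext j k
      simpa [Matrix.one_apply, apply_ite] using mul_comm _ _
    refine ⟨Y * (1 + (X ^ (T + 1) : ℂ[X]) • x.map C), ?_, E', hE', ?_⟩
    · rw [heval, hY, zero_pow T.succ_ne_zero, zero_smul, add_zero, mul_one]
    simp only [heval]
    filter_upwards [hgauge, hstep] with ζ hζ hstepζ using hζ.mul hstepζ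

end ApproximateGauge

section Existence

open scoped Matrix.Norms.Operator

variable {r : ℕ} {m : Fin r → ℤ}

theorem exists_hasPolarPart_affineForm (m : Fin r → ℤ) (b : Fin r → ℂ) : ∃ T : ℕ,
    ∀ E : ℂ → Matrix (Fin r) (Fin r) ℂ, AnalyticAt ℂ E 0 →
      HasPolarPart (affineForm m fun ζ => ζ⁻¹ • Matrix.diagonal b + ζ ^ T • E ζ)
        (Matrix.diagonal b + splitN m) := by
  obtain ⟨T, hT⟩ := exists_pow_smul_powN_conj_analyticAt m
  refine ⟨T, fun E hE => ?_⟩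
  obtain ⟨F, hF, hEF⟩ := hT E hE
  refine hasPolarPart_iff.2 ⟨F, hF, ?_⟩
  filter_upwards [self_mem_nhdsWithin] with ζ hζ
  have hcomm : powN m ζ⁻¹ * Matrix.diagonal b = Matrix.diagonal b * powN m ζ⁻¹ := by
    simp only [powN, Matrix.diagonal_mul_diagonal, mul_comm]
  simp only [affineForm, mul_add, add_mul, mul_smul_comm, smul_mul_assoc, hcomm, mul_assoc,
    powN_inv_mul_powN m hζ, mul_one, ← hEF ζ hζ, smul_add]
  abel

theorem exists_bundleAut_hasPolarPart {A : ℂ → Matrix (Fin r) (Fin r) ℂ}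
    {Y₀ : Matrix (Fin r) (Fin r) ℂ} {b : Fin r → ℂ}
    (hA : HasPolarPart (formAtInfty m A) (matAd Y₀ (Matrix.diagonal b))) (hY₀ : IsUnit Y₀)
    (hcorner : ∀ c : ℤ, IsUnit (Y₀.toSquareBlockProp fun i => m i ≤ c))
    (hb : ∀ j k, ∀ s : ℕ, b j - b k + (s + 1) ≠ 0) :
    ∃ g : BundleAut m, HasPolarPart (inZeta (g.act A)) (Matrix.diagonal b + splitN m) := by
  obtain ⟨T, hT⟩ := exists_hasPolarPart_affineForm m b
  obtain ⟨Y, rfl, E, hE, hY⟩ := exists_polynomial_gauge hA hY₀ hb T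
  obtain ⟨g, H, hgH⟩ := exists_bundleAut_mul_eq_one_add_smul hcorner
  have hH : AnalyticAt ℂ (fun ζ => H.map (Polynomial.eval ζ)) 0 :=
    analyticAt_matrix_iff.2 fun j k => (H j k).differentiable.analyticAt 0
  have hgauge : ∀ᶠ ζ in 𝓝[≠] 0, IsGaugeAt
      (fun ζ => g.g₀ ζ⁻¹ * (powN m ζ⁻¹ * (Y.map (Polynomial.eval ζ) * powN m ζ)))
      (affineForm m fun ζ => ζ⁻¹ • Matrix.diagonal b + ζ ^ T • E ζ) (inZeta (g.act A)) ζ := by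
    filter_upwards [hY, self_mem_nhdsWithin] with ζ hYζ hζ
    have hinv : IsGaugeAt (fun ζ => powN m ζ⁻¹) (formAtInfty m A) (inZeta A) ζ := by
      simpa only [IsGaugeAt, affineForm_formAtInfty A hζ] using
        isGaugeAt_powN_inv (m := m) (Φ := formAtInfty m A) hζ
    exact (g.isGaugeAt A hζ).mul (hinv.mul (hYζ.mul (isGaugeAt_powN hζ)))
  have hcomposite : (fun ζ => g.g₀ ζ⁻¹ * (powN m ζ⁻¹ * (Y.map (Polynomial.eval ζ) * powN m ζ)))
      =ᶠ[𝓝[≠] 0] fun ζ => 1 + ζ • H.map (Polynomial.eval ζ) := by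
    filter_upwards [self_mem_nhdsWithin] with ζ hζ
    rw [← hgH ζ hζ, g.transition ζ⁻¹ (inv_ne_zero hζ), inv_inv]
    simp only [mul_assoc]
    rw [← mul_assoc (powN m ζ), powN_mul_powN_inv m hζ, one_mul]
  have hu : AnalyticAt ℂ (fun ζ : ℂ => 1 + ζ • H.map (Polynomial.eval ζ)) 0 :=
    analyticAt_const.add (analyticAt_id.smul hH)
  have hpolar := (hT E hE).of_isGaugeAt hu (by simp) (eventually_isGaugeAt_congr hcomposite hgauge)
  rw [zero_smul, add_zero, matAd, one_mul, inv_one, mul_one] at hpolar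
  exact ⟨g, hpolar⟩

end Existence

section Uniqueness

open scoped Matrix.Norms.Operator

variable {r : ℕ} {u Φ Ψ : ℂ → Matrix (Fin r) (Fin r) ℂ} {μ ν : Fin r → ℂ}

theorem residue_eq_of_gauge_apply_ne_zero (hΦ : HasPolarPart Φ (Matrix.diagonal ν))
    (hΨ : HasPolarPart Ψ (Matrix.diagonal μ)) (hu : AnalyticAt ℂ u 0)
    (hgauge : ∀ᶠ ζ in 𝓝[≠] 0, IsGaugeAt u Φ Ψ ζ) {j k : Fin r} (hjk : u 0 j k ≠ 0) :
    μ j = ν k := by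
  have hcomm : Matrix.diagonal μ * u 0 = u 0 * Matrix.diagonal ν :=
    IsGaugeAt.residue_comm hu hΦ.tendsto_smul hΨ.tendsto_smul hgauge
  have happly := congrFun₂ hcomm j k
  rw [Matrix.diagonal_mul, Matrix.mul_diagonal, mul_comm] at happly
  exact mul_left_cancel₀ hjk happly

variable {q : ℂ → Matrix (Fin r) (Fin r) ℂ}

theorem exists_analyticAt_eventuallyEq_gauge (hΦ : HasPolarPart Φ (Matrix.diagonal μ))
    (hΨ : HasPolarPart Ψ (Matrix.diagonal μ)) (hμ : ∀ j k, ∀ s : ℕ, μ j - μ k = s → j = k)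
    (hq : ∀ᶠ ζ in 𝓝[≠] 0, IsGaugeAt q Φ Ψ ζ) (s : ℕ) (hu : AnalyticAt ℂ u 0)
    (huq : u =ᶠ[𝓝[≠] 0] fun ζ => ζ ^ s • q ζ) :
    ∃ v, AnalyticAt ℂ v 0 ∧ q =ᶠ[𝓝[≠] 0] v := by
  induction s generalizing u with
  | zero => exact ⟨u, hu, by simpa only [pow_zero, one_smul] using huq.symm⟩
  | succ s ih =>
    have hpolar := hΦ.inv_smul_add ((s + 1 : ℕ) : Matrix (Fin r) (Fin r) ℂ)
    rw [← Matrix.diagonal_natCast, Matrix.diagonal_add] at hpolar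
    have hgauge : ∀ᶠ ζ in 𝓝[≠] 0,
        IsGaugeAt u (fun ζ => ζ⁻¹ • Matrix.diagonal (fun _ => ((s + 1 : ℕ) : ℂ)) + Φ ζ) Ψ ζ := by
      refine eventually_isGaugeAt_congr huq.symm ?_
      filter_upwards [hq, self_mem_nhdsWithin] with ζ hqζ hζ using hqζ.pow_smul hζ (s + 1)
    have hu0 : u 0 = 0 := by
      ext j k
      by_contra hjk
      have hres := residue_eq_of_gauge_apply_ne_zero hpolar hΨ hu hgauge hjk
      obtain rfl := hμ j k (s + 1) (sub_eq_iff_eq_add.2 hres)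
      exact Nat.cast_ne_zero.2 s.succ_ne_zero (add_eq_right.1 hres.symm)
    obtain ⟨g, hg, hug⟩ := exists_analyticAt_eq_add_smul hu
    refine ih hg ?_
    filter_upwards [huq, self_mem_nhdsWithin] with ζ hζ hne
    rw [hug, hu0, zero_add, pow_succ', mul_smul] at hζ
    exact smul_right_injective _ hne hζ

theorem exists_diagonal_tendsto_gauge (hΦ : HasPolarPart Φ (Matrix.diagonal μ))
    (hΨ : HasPolarPart Ψ (Matrix.diagonal μ)) (hμ : ∀ j k, ∀ s : ℕ, μ j - μ k = s → j = k)
    (hq : ∀ᶠ ζ in 𝓝[≠] 0, IsGaugeAt q Φ Ψ ζ) (s : ℕ) (hu : AnalyticAt ℂ u 0)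
    (huq : u =ᶠ[𝓝[≠] 0] fun ζ => ζ ^ s • q ζ) :
    ∃ d, Tendsto q (𝓝[≠] 0) (𝓝 (Matrix.diagonal d)) := by
  obtain ⟨v, hv, hqv⟩ := exists_analyticAt_eventuallyEq_gauge hΦ hΨ hμ hq s hu huq
  have hdiag : (v 0).IsDiag := fun j k hjk => by
    by_contra hne
    have hres := residue_eq_of_gauge_apply_ne_zero hΦ hΨ hv (eventually_isGaugeAt_congr hqv hq) hne
    exact hjk (hμ j k 0 (by rw [hres, sub_self, Nat.cast_zero]))
  refine ⟨(v 0).diag, ?_⟩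
  rw [hdiag.diagonal_diag]
  exact (hv.continuousAt.tendsto.mono_left nhdsWithin_le_nhds).congr' hqv.symm

variable {m : Fin r → ℤ} {A : ℂ → Matrix (Fin r) (Fin r) ℂ}

theorem BundleAut.isGaugeAt_div (h g : BundleAut m) (A : ℂ → Matrix (Fin r) (Fin r) ℂ) {ζ : ℂ}
    (hζ : ζ ≠ 0) : IsGaugeAt (fun ζ => h.g₀ ζ⁻¹ * Ring.inverse (g.g₀ ζ⁻¹))
      (inZeta (g.act A)) (inZeta (h.act A)) ζ :=
  (h.isGaugeAt A hζ).mul ((g.isGaugeAt A hζ).inverse (g.isUnit₀ ζ⁻¹))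

theorem BundleAut.g₀_div_eq_powN_conj (h g : BundleAut m) {ζ : ℂ} (hζ : ζ ≠ 0) :
    h.g₀ ζ⁻¹ * Ring.inverse (g.g₀ ζ⁻¹)
      = powN m ζ⁻¹ * (h.g₁ ζ * Ring.inverse (g.g₁ ζ)) * powN m ζ := by
  refine (g.isUnit₀ ζ⁻¹).mul_right_cancel ?_
  rw [Ring.inverse_mul_cancel_right _ _ (g.isUnit₀ ζ⁻¹), h.transition _ (inv_ne_zero hζ),
    g.transition _ (inv_ne_zero hζ), inv_inv]
  simp only [mul_assoc]
  rw [← mul_assoc (powN m ζ), powN_mul_powN_inv m hζ, one_mul,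
    Ring.inverse_mul_cancel_left _ _ (g.isUnit₁ ζ)]

theorem BundleAut.exists_diagonal_of_hasPolarPart {g h : BundleAut m}
    (hμ : ∀ j k, ∀ s : ℕ, μ j - μ k = s → j = k)
    (hg : HasPolarPart (inZeta (g.act A)) (Matrix.diagonal μ))
    (hh : HasPolarPart (inZeta (h.act A)) (Matrix.diagonal μ)) :
    ∃ d : Fin r → ℂ, (∀ j, d j ≠ 0) ∧ ∀ w, h.g₀ w = Matrix.diagonal d * g.g₀ w := by
  obtain ⟨T, hT⟩ := exists_pow_smul_powN_conj_analyticAt m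
  have hg₀ := matEntire_iff_differentiable.1 g.entire₀
  have hg₁ := matEntire_iff_differentiable.1 g.entire₁
  obtain ⟨F, hF, hTF⟩ := hT (fun ζ => h.g₁ ζ * Ring.inverse (g.g₁ ζ))
    (((matEntire_iff_differentiable.1 h.entire₁).analyticAt 0).mul
      (analyticAt_ringInverse_comp (hg₁.analyticAt 0) (g.isUnit₁ 0)))
  have hdiff : Differentiable ℂ fun z => h.g₀ z * Ring.inverse (g.g₀ z) :=
    (matEntire_iff_differentiable.1 h.entire₀).fun_mul fun z =>
      (analyticAt_ringInverse_comp (hg₀.analyticAt z) (g.isUnit₀ z)).differentiableAt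
  obtain ⟨d, hd⟩ := exists_diagonal_tendsto_gauge hg hh hμ
    (eventually_nhdsWithin_of_forall fun ζ hζ => h.isGaugeAt_div g A hζ) T hF
    (eventually_nhdsWithin_of_forall fun ζ hζ => by
      rw [← hTF ζ hζ, ← h.g₀_div_eq_powN_conj g hζ])
  have hconst := apply_eq_of_tendsto_comp_inv hdiff hd
  refine ⟨d, fun j => ?_, fun w => ?_⟩
  · have hunit : IsUnit (Matrix.diagonal d) :=
      hconst 0 ▸ (h.isUnit₀ 0).mul (g.isUnit₀ 0).ringInverse
    exact (Pi.isUnit_iff.1 (Matrix.isUnit_diagonal.1 hunit) j).ne_zero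
  · rw [← hconst w, Ring.inverse_mul_cancel_right _ _ (g.isUnit₀ w)]

theorem BundleAut.hasPolarPart_of_eq_diagonal_mul {g h : BundleAut m}
    (hg : HasPolarPart (inZeta (g.act A)) (Matrix.diagonal μ)) {d : Fin r → ℂ}
    (hd : ∀ j, d j ≠ 0) (hgh : ∀ w, h.g₀ w = Matrix.diagonal d * g.g₀ w) :
    HasPolarPart (inZeta (h.act A)) (Matrix.diagonal μ) := by
  have hunit : IsUnit (Matrix.diagonal d) :=
    Matrix.isUnit_diagonal.2 (Pi.isUnit_iff.2 fun j => (hd j).isUnit)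
  have hcomm : Matrix.diagonal d * Matrix.diagonal μ = Matrix.diagonal μ * Matrix.diagonal d := by
    simp only [Matrix.diagonal_mul_diagonal, mul_comm]
  have hgauge : ∀ᶠ ζ in 𝓝[≠] 0,
      IsGaugeAt (fun _ => Matrix.diagonal d) (inZeta (g.act A)) (inZeta (h.act A)) ζ :=
    eventually_nhdsWithin_of_forall fun ζ hζ => by
      simpa only [hgh, Ring.mul_inverse_cancel_right _ _ (g.isUnit₀ _)] using
        h.isGaugeAt_div g A hζ
  have hpolar := hg.of_isGaugeAt analyticAt_const hunit hgauge
  rwa [matAd, hcomm, Matrix.mul_nonsing_inv_cancel_right _ _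
    ((Matrix.isUnit_iff_isUnit_det _).1 hunit)] at hpolar

end Uniqueness

section PermutedResidue

variable {r : ℕ} (σ : Equiv.Perm (Fin r))

theorem matAd_permMatrix_diagonal (a : Fin r → ℂ) :
    matAd (σ.permMatrix ℂ) (Matrix.diagonal a) = Matrix.diagonal (a ∘ σ) := by
  rw [matAd, permMatrix_mul_mul_inv, Matrix.submatrix_diagonal _ _ σ.injective]

theorem matAd_mul_inv_matAd {S : Matrix (Fin r) (Fin r) ℂ} (hS : IsUnit S)
    (B X : Matrix (Fin r) (Fin r) ℂ) : matAd (B * S⁻¹) (matAd S X) = matAd B X := by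
  have hdet := (Matrix.isUnit_iff_isUnit_det _).1 hS
  simp only [matAd, Matrix.mul_inv_rev, Matrix.nonsing_inv_nonsing_inv _ hdet, mul_assoc,
    Matrix.nonsing_inv_mul_cancel_left _ _ hdet]

theorem matAd_add_matAd_inv {S : Matrix (Fin r) (Fin r) ℂ} (hS : IsUnit S)
    (X Y : Matrix (Fin r) (Fin r) ℂ) : matAd S (X + matAd S⁻¹ Y) = matAd S X + Y := by
  have hdet := (Matrix.isUnit_iff_isUnit_det _).1 hS
  simp only [matAd, mul_add, add_mul, Matrix.nonsing_inv_nonsing_inv _ hdet, mul_assoc,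
    Matrix.mul_nonsing_inv _ hdet, Matrix.mul_nonsing_inv_cancel_left _ _ hdet, mul_one]

theorem isNormalizedAtInfty_iff {m : Fin r → ℤ} {a : Fin r → ℝ}
    {A : ℂ → Matrix (Fin r) (Fin r) ℂ} : IsNormalizedAtInfty m a σ A ↔
      HasPolarPart (inZeta A) (Matrix.diagonal fun j => (a (σ j) : ℂ) + m j) := by
  simp only [IsNormalizedAtInfty, weightW, matAd_add_matAd_inv (isUnit_permMatrix σ),
    matAd_permMatrix_diagonal, splitN, Matrix.diagonal_add, Function.comp_apply]

end PermutedResidue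

theorem eq_of_strictMono_of_sub_eq_intCast {ι : Type*} [LinearOrder ι] {a : ι → ℝ}
    (ha : StrictMono a) (h0 : ∀ j, 0 ≤ a j) (h1 : ∀ j, a j < 1) {j k : ι} {n : ℤ}
    (h : a j - a k = n) : j = k := by
  apply ha.injective
  rw [← Int.fract_eq_self.2 ⟨h0 j, h1 j⟩, ← Int.fract_eq_self.2 ⟨h0 k, h1 k⟩]
  exact Int.fract_eq_fract.2 ⟨n, h⟩

theorem mainTheorem6_general {r : ℕ} (m : Fin r → ℤ) {a : Fin r → ℂ}
    (ha : ∀ i j, ∀ n : ℤ, a i - a j = n → i = j) {B : Matrix (Fin r) (Fin r) ℂ} (hB : IsUnit B)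
    {A : ℂ → Matrix (Fin r) (Fin r) ℂ}
    (hA : HasPolarPart (formAtInfty m A) (matAd B (Matrix.diagonal a))) :
    (∃ σ : Equiv.Perm (Fin r), IsBruhatRep m (flagAct B (stdFlag r)) σ) ∧
    ∀ σ : Equiv.Perm (Fin r), IsBruhatRep m (flagAct B (stdFlag r)) σ →
      ∃ g : BundleAut m,
        HasPolarPart (inZeta (g.act A)) (Matrix.diagonal fun j => a (σ j) + m j) ∧
        ∀ h : BundleAut m,
          HasPolarPart (inZeta (h.act A)) (Matrix.diagonal fun j => a (σ j) + m j) ↔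
            ∃ d : Fin r → ℂ, (∀ j, d j ≠ 0) ∧ ∀ w, h.g₀ w = Matrix.diagonal d * g.g₀ w := by
  refine ⟨exists_isBruhatRep m hB, fun σ hσ => ?_⟩
  have hS := isUnit_permMatrix (R := ℂ) σ
  have hb : ∀ j k, ∀ s : ℕ, (a ∘ σ) j - (a ∘ σ) k + (s + 1) ≠ 0 := fun j k s hs => by
    obtain rfl := σ.injective
      (ha (σ j) (σ k) (-(s + 1)) (by push_cast; exact eq_neg_of_add_eq_zero_left hs))
    rw [sub_self, zero_add] at hs
    exact Nat.cast_add_one_ne_zero s hs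
  have hμ : ∀ j k, ∀ s : ℕ, a (σ j) + m j - (a (σ k) + m k) = s → j = k := fun j k s hs =>
    σ.injective (ha _ _ (s - m j + m k) (by push_cast; linear_combination hs))
  rw [← matAd_mul_inv_matAd hS, matAd_permMatrix_diagonal] at hA
  obtain ⟨g, hg⟩ := exists_bundleAut_hasPolarPart hA (hB.mul (Matrix.isUnit_nonsing_inv_iff.2 hS))
    (hσ.isUnit_corner hB) hb
  rw [splitN, Matrix.diagonal_add] at hg
  exact ⟨g, hg, fun h => ⟨BundleAut.exists_diagonal_of_hasPolarPart hμ hg,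
    fun ⟨d, hd, hgh⟩ => BundleAut.hasPolarPart_of_eq_diagonal_mul hg hd hgh⟩⟩

theorem mainTheorem6 {k r : ℕ} (z : Fin k → ℂ) (hz : Function.Injective z)
    (m : Fin r → ℤ) (hm : Monotone m)
    (α : Fin (k + 1) → Fin r → ℝ) (hα : ∀ i, StrictMono (α i))
    (hα0 : ∀ i j, 0 ≤ α i j) (hα1 : ∀ i j, α i j < 1)
    (F : Fin (k + 1) → Fin r → Submodule ℂ (Fin r → ℂ))
    (A : ℂ → Matrix (Fin r) (Fin r) ℂ) (hA : IsAdaptedConnection z m α F A) :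
    (∃ σ : Equiv.Perm (Fin r), IsBruhatRep m (F (Fin.last k)) σ) ∧
    ∀ σ : Equiv.Perm (Fin r), IsBruhatRep m (F (Fin.last k)) σ →
      ∃ g : BundleAut m, IsNormalizedAtInfty m (α (Fin.last k)) σ (g.act A) ∧
        ∀ h : BundleAut m, IsNormalizedAtInfty m (α (Fin.last k)) σ (h.act A) ↔
          ∃ d : Fin r → ℂ, (∀ j, d j ≠ 0) ∧ ∀ w, h.g₀ w = Matrix.diagonal d * g.g₀ w := by
  obtain ⟨R, -, -, -, hpolar, hres⟩ := hA
  obtain ⟨B, hB, hRB, hF⟩ := hres (Fin.last k)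
  have hdistinct : ∀ i j, ∀ n : ℤ, (α (Fin.last k) i : ℂ) - α (Fin.last k) j = n → i = j :=
    fun i j n h => eq_of_strictMono_of_sub_eq_intCast (hα _) (hα0 _) (hα1 _) (n := n)
      (by exact_mod_cast h)
  rw [hRB, weightW] at hpolar
  simp only [hF, isNormalizedAtInfty_iff]
  exact mainTheorem6_general m hdistinct hB hpolar
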